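/- Let $\gamma_1,\rho_1\in(0,1)$ and set $\gamma_n=\gamma_1/\sqrt n$, $\rho_n=\rho_1/\sqrt n$ for $n\ge 1$. For $p_1,p_2\in[0,1]$ let $(A_n^1)_n$ and $(A_n^2)_n$ be two independent sequences of i.i.d. Bernoulli random variables with parameters $p_1$ and $p_2$ (the rewards of arms $1$ and $2$). The two-armed penalized Narendra–Shapiro algorithm starts from an initial weight $X_0\in[0,1]$ and, at each time $n+1$ ($n\ge 0$), plays arm $I_{n+1}\in\{1,2\}$, where $$\mathbb P(I_{n+1}=1\mid\mathcal F_n)=X_n,\qquad \mathbb P(I_{n+1}=2\mid\mathcal F_n)=1-X_n,\qquad \mathcal F_n=\sigma\big(X_0,(I_1,A_1^{I_1}),\dots,(I_n,A_n^{I_n})\big),$$ the rewards $(A^1_{n+1},A^2_{n+1})$ being independent of $(\mathcal F_n,I_{n+1})$, and updates $$X_{n+1}=X_n+\gamma_{n+1}\big[\mathbf 1_{I_{n+1}=1}-X_n\big]A_{n+1}^{I_{n+1}}-\gamma_{n+1}\rho_{n+1}\big[X_n\mathbf 1_{I_{n+1}=1}-(1-X_n)\mathbf 1_{I_{n+1}=2}\big]\big(1-A_{n+1}^{I_{n+1}}\big).$$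 Its pseudo-regret after $n$ plays is $\bar R_n=\max_{j\in\{1,2\}}\mathbb E\sum_{k=1}^n\big[A_k^j-A_k^{I_k}\big]$. Then for every $\delta\in(0,1)$ there is a constant $C_\delta>0$, depending only on $\delta,\gamma_1,\rho_1$, such that $$\forall n\in\mathbb N,\qquad \sup_{(p_1,p_2)\in[0,1]^2,\ p_2\le \min(p_1,1-\delta)}\bar R_n\le C_\delta\sqrt n,$$ and this holds for every choice of the initial weight $X_0$ with values in $[0,1]$. -/

import Mathlib

open MeasureTheory ProbabilityTheory

noncomputable section

namespace PenalizedNS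

/-- The sequence `n ↦ c / √n` (used for `n ≥ 1`). -/
def invSqrt (c : ℝ) (n : ℕ) : ℝ := c / √(n : ℝ)

variable {Ω : Type*}

/-- The information available to the player after `n` plays: the σ-algebra generated by the initial
weight `X 0` and by the observed pairs `(I_k, A_k^{I_k})`, `1 ≤ k ≤ n`. -/
abbrev history (A : ℕ → Fin 2 → Ω → ℝ) (I : ℕ → Ω → Fin 2) (X : ℕ → Ω → ℝ) (n : ℕ) :
    MeasurableSpace Ω :=
  MeasurableSpace.comap (X 0) inferInstance ⊔
    ⨆ k ∈ Finset.Icc 1 n, MeasurableSpace.comap (fun ω => (I k ω, A k (I k ω) ω)) inferInstance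

/-- The two-armed penalized Narendra–Shapiro algorithm with step sizes `γ`, penalties `ρ` and
success probabilities `p`. The first arm is `0 : Fin 2`, the second one is `1 : Fin 2`;
`A n j` is the reward of arm `j` at time `n`, `I n` is the arm played at time `n ≥ 1`, and `X n` is
the probability of playing the first arm at time `n + 1`. -/
structure IsPenalizedNS [MeasurableSpace Ω] (μ : Measure Ω) (γ ρ : ℕ → ℝ)
    (p : Fin 2 → unitInterval) (A : ℕ → Fin 2 → Ω → ℝ) (I : ℕ → Ω → Fin 2) (X : ℕ → Ω → ℝ) :
    Prop where
  measurable_reward : ∀ n j, Measurable (A n j)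
  measurable_arm : ∀ n, Measurable (I n)
  measurable_init : Measurable (X 0)
  /-- The rewards of arm `j` have the Bernoulli law with parameter `p j` on `{0, 1}`. -/
  reward_law : ∀ n j, HasLaw (A n j) (bernoulliMeasure (1 : ℝ) 0 (p j)) μ
  /-- All rewards (over all times and both arms) are independent. -/
  reward_indep : iIndepFun (fun k : ℕ × Fin 2 => A k.1 k.2) μ
  init_mem : ∀ ω, X 0 ω ∈ Set.Icc (0 : ℝ) 1
  /-- Given the past, the first arm is played at time `n + 1` with probability `X n`. -/
  arm_law : ∀ n,
    μ[({ω | I (n + 1) ω = 0} : Set Ω).indicator (fun _ => (1 : ℝ)) | history A I X n] =ᵐ[μ] X n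
  /-- The rewards at time `n + 1` are independent of the past and of the choice of the arm. -/
  reward_indep_arm : ∀ n,
    Indep (MeasurableSpace.comap (fun ω j => A (n + 1) j ω) inferInstance)
      (history A I X n ⊔ MeasurableSpace.comap (I (n + 1)) inferInstance) μ
  update : ∀ n ω, X (n + 1) ω =
    X n ω
      + γ (n + 1) * ((if I (n + 1) ω = 0 then 1 else 0) - X n ω) * A (n + 1) (I (n + 1) ω) ω
      - γ (n + 1) * ρ (n + 1)
        * (X n ω * (if I (n + 1) ω = 0 then 1 else 0)
            - (1 - X n ω) * (if I (n + 1) ω = 1 then 1 else 0))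
        * (1 - A (n + 1) (I (n + 1) ω) ω)

/-- The pseudo-regret `max_j 𝔼 ∑_{k=1}^n (A_k^j - A_k^{I_k})`. -/
def pseudoRegret [MeasurableSpace Ω] (μ : Measure Ω) (A : ℕ → Fin 2 → Ω → ℝ) (I : ℕ → Ω → Fin 2)
    (n : ℕ) : ℝ :=
  Finset.univ.sup' Finset.univ_nonempty fun j : Fin 2 =>
    ∫ ω, ∑ k ∈ Finset.Icc 1 n, (A k j ω - A k (I k ω) ω) ∂μ

end PenalizedNS

end

namespace PenalizedNS

/-! Write p, q for the success probabilities of the better and worse arm, π = p - q, and g, r for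
the current step size and penalty. The pseudo-regret is at most π ∑ 𝔼(1 - X_k), so this sum must be
O(√n) uniformly in π.

The tool is the Lyapunov function 1/(x + a) with a = 6g/π. This shift makes a jump of size at most g
no larger than (π/6)(x + a), so linearizing costs only a fraction of the drift. To first order the
conditional drift is -g(1 - x)[πx + (1 - q)r(1 - x)]/(x + a)², plus an error O(gr) from penalizing
the better arm. The bracket dominates a multiple of π(x + a): for x ≥ 1/2 through πx, and for x ≤
1/2 because πa = 6g is of the order of r while 1 - q ≥ δ. So the penalty is what drives the weight
away from the wrong vertex. The result is `lyapunov_drift`.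

Put u_n = 𝔼[1/(X_n + a_n)] and w_n = 𝔼[(1 - X_n)/(X_n + a_n)] ≥ u_n - 1. Since gr = O(1/n), the
drift reads u_{n+1} ≤ u_n - cπ w_n/√(n+1) + D/(n+1) as soon as π√(n+1) ≥ B. This bounds u;
multiplying by √(n+1) and summing by parts then bounds π ∑ w (`sum_le_of_recursion`). Before that
threshold the trivial estimate πN ≤ B√N suffices. No constant depends on π. -/

/-! ### Pointwise drift of the Lyapunov function. -/

lemma one_div_add_le {s h t : ℝ} (hs : 0 < s) (hh : 0 ≤ h) (hst : h ≤ t * s) :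
    1 / (s + h) ≤ 1 / s - h * (1 - t) / s ^ 2 := by
  have hsh : 0 < s + h := by linarith
  have key : 1 / s - h * (1 - t) / s ^ 2 - 1 / (s + h)
      = h * ((t * s - h) + t * h) / (s ^ 2 * (s + h)) := by
    field_simp
    ring
  have ht : 0 ≤ t := by
    by_contra! ht
    nlinarith
  have : 0 ≤ h * ((t * s - h) + t * h) / (s ^ 2 * (s + h)) := by
    have : 0 ≤ t * s - h := by linarith
    positivity
  linarith

lemma one_div_sub_le {s h t : ℝ} (hs : 0 < s) (hh : 0 ≤ h) (hst : h ≤ t * s) (ht : t < 1) :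
    1 / (s - h) ≤ 1 / s + h / (1 - t) / s ^ 2 := by
  have hsh : 0 < s - h := by nlinarith
  have ht' : 0 < 1 - t := by linarith
  have key : 1 / s + h / (1 - t) / s ^ 2 - 1 / (s - h)
      = h * (t * s - h) / ((1 - t) * s ^ 2 * (s - h)) := by
    field_simp
    ring
  have : 0 ≤ h * (t * s - h) / ((1 - t) * s ^ 2 * (s - h)) := by
    have : 0 ≤ t * s - h := by linarith
    positivity
  linarith

/-- Lower bound for the bracket in the drift, with linearization errors included. Splitting at x =
1/2: above it a ≤ x, and the gap π alone suffices; below it the penalty pays for cπa = 6cg ≤ δr/8.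
-/
lemma drift_coeff_le {x a g r p q π δ c : ℝ} (hx : x ∈ Set.Icc (0 : ℝ) 1) (ha : 0 < a)
    (ha2 : a ≤ 1 / 2) (hg : 0 < g) (hr : 0 < r) (hp : p ≤ 1) (hπ : π = p - q) (hπ0 : 0 ≤ π)
    (hqδ : q ≤ 1 - δ) (hδ : 0 ≤ δ) (hag : a * π = 6 * g) (hc : 0 ≤ c) (hc4 : c ≤ 1 / 4)
    (hcr : 48 * c * g ≤ δ * r) :
    x * (-p * (1 - π / 6) + q * (1 + π / 3)) - (1 - q) * r * (1 - x) / 2 ≤ -(c * π * (x + a)) := by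
  obtain ⟨hx0, hx1⟩ := hx
  have hy0 : 0 ≤ 1 - x := by linarith
  have hmain : c * π * (x + a) ≤ x * (π / 2) + δ * r * (1 - x) / 2 := by
    have e : c * π * a = 6 * (c * g) := by linear_combination c * hag
    have hcx : c * (π * x) ≤ 1 / 4 * (π * x) := by gcongr
    rcases le_total x (1 / 2) with h | h
    · have : δ * r * (1 / 2) ≤ δ * r * (1 - x) := by
        gcongr
        linarith
      have h1 := mul_nonneg hπ0 hx0
      have h2 := mul_nonneg hc hg.le
      linarith
    · have h1 : c * (π * a) ≤ 1 / 4 * (π * x) := by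
        gcongr
        linarith
      have : 0 ≤ δ * r * (1 - x) := by positivity
      linarith
  -- The left side equals -π + π(p + 2q)/6, and p + 2q ≤ 3: the linearization consumes at most half
  -- of the gap.
  have hdrift : -p * (1 - π / 6) + q * (1 + π / 3) ≤ -(π / 2) := by
    have : π * (p + 2 * q) ≤ π * 3 := by gcongr; linarith
    linarith
  have h2 := mul_le_mul_of_nonneg_left hdrift hx0
  have h3 : δ * (r * (1 - x)) ≤ (1 - q) * (r * (1 - x)) := by
    gcongr
    linarith
  linarith

/-- Each of the four outcomes is linearized separately. The two reward terms need relative error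
O(π), because their leading parts nearly cancel when p is close to q; for the penalty terms a
constant factor is enough. -/
lemma sum_outcomes_le {x a g r p q π κ : ℝ} (hx : x ∈ Set.Icc (0 : ℝ) 1) (ha : 0 < a)
    (hg : 0 < g) (hr : 0 < r) (hr1 : r ≤ 1) (hκ : g * r ≤ κ) (hκ1 : κ < 1) (hp0 : 0 ≤ p)
    (hp : p ≤ 1) (hq : 0 ≤ q) (hq1 : q ≤ 1) (hπ0 : 0 ≤ π) (hπ1 : π ≤ 1) (hag : a * π = 6 * g) :
    x * (p * (1 / (x + g * (1 - x) + a)) + (1 - p) * (1 / (x - g * r * x + a)))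
      + (1 - x) * (q * (1 / (x - g * x + a)) + (1 - q) * (1 / (x + g * r * (1 - x) + a)))
      ≤ x * (p * (1 / (x + a) - g * (1 - x) * (1 - π / 6) / (x + a) ^ 2)
          + (1 - p) * (1 / (x + a) + g * r * x / (1 - κ) / (x + a) ^ 2))
        + (1 - x) * (q * (1 / (x + a) + g * x * (1 + π / 3) / (x + a) ^ 2)
          + (1 - q) * (1 / (x + a) - g * r * (1 - x) * (1 / 2) / (x + a) ^ 2)) := by
  obtain ⟨hx0, hx1⟩ := hx
  have hs : 0 < x + a := by positivity
  have hy0 : 0 ≤ 1 - x := by linarith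
  have hgs : g ≤ π / 6 * (x + a) := by
    have := mul_nonneg hπ0 hx0
    linarith
  have hgy : g * (1 - x) ≤ g := mul_le_of_le_one_right hg.le (by linarith)
  have b1 : 1 / (x + g * (1 - x) + a)
      ≤ 1 / (x + a) - g * (1 - x) * (1 - π / 6) / (x + a) ^ 2 := by
    rw [show x + g * (1 - x) + a = x + a + g * (1 - x) by ring]
    exact one_div_add_le hs (by positivity) (hgy.trans hgs)
  -- This jump is proportional to x, so its ratio to x + a is at most gr ≤ κ, without using the size
  -- of a.
  have b2 : 1 / (x - g * r * x + a) ≤ 1 / (x + a) + g * r * x / (1 - κ) / (x + a) ^ 2 := by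
    rw [show x - g * r * x + a = x + a - g * r * x by ring]
    exact one_div_sub_le hs (by positivity)
      (mul_le_mul hκ (by linarith) hx0 (le_trans (by positivity) hκ)) hκ1
  have b3 : 1 / (x - g * x + a) ≤ 1 / (x + a) + g * x * (1 + π / 3) / (x + a) ^ 2 := by
    rw [show x - g * x + a = x + a - g * x by ring]
    refine (one_div_sub_le (t := π / 6) hs (by positivity)
      ((mul_le_of_le_one_right hg.le hx1).trans hgs) (by linarith)).trans ?_
    gcongr
    -- Here (1 + π/3)(1 - π/6) ≥ 1 because 0 ≤ π ≤ 1.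
    rw [div_le_iff₀ (by linarith), mul_assoc]
    refine le_mul_of_one_le_right (by positivity) ?_
    have := mul_le_mul_of_nonneg_left hπ1 hπ0
    linarith
  have b4 : 1 / (x + g * r * (1 - x) + a)
      ≤ 1 / (x + a) - g * r * (1 - x) * (1 / 2) / (x + a) ^ 2 := by
    rw [show x + g * r * (1 - x) + a = x + a + g * r * (1 - x) by ring,
      show (1 / 2 : ℝ) = 1 - 1 / 2 by norm_num]
    refine one_div_add_le hs (by positivity) (le_trans ?_ (hgs.trans (by gcongr; linarith)))
    rw [mul_right_comm]
    exact (mul_le_of_le_one_right (by positivity) hr1).trans hgy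
  have hp1 : 0 ≤ 1 - p := by linarith
  have hq1 : 0 ≤ 1 - q := by linarith
  gcongr

/-- One-step drift of the Lyapunov function `x ↦ 1 / (x + a)` along the algorithm. -/
lemma lyapunov_drift {x a g r p q δ κ c : ℝ} (hx : x ∈ Set.Icc (0 : ℝ) 1) (ha : 0 < a)
    (ha2 : a ≤ 1 / 2) (hg : 0 < g) (hr : 0 < r) (hr1 : r ≤ 1) (hκ : g * r ≤ κ)
    (hκ1 : κ < 1) (hp : p ≤ 1) (hq : 0 ≤ q) (hqp : q ≤ p) (hqδ : q ≤ 1 - δ)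
    (hδ : 0 ≤ δ) (hag : a * (p - q) = 6 * g) (hc : 0 ≤ c) (hc4 : c ≤ 1 / 4)
    (hcr : 48 * c * g ≤ δ * r) :
    x * (p * (1 / (x + g * (1 - x) + a)) + (1 - p) * (1 / (x - g * r * x + a)))
      + (1 - x) * (q * (1 / (x - g * x + a)) + (1 - q) * (1 / (x + g * r * (1 - x) + a)))
      ≤ 1 / (x + a) - g * c * (p - q) * ((1 - x) * (1 / (x + a))) + g * r * (1 / (1 - κ)) := by
  obtain ⟨π, hπ⟩ : ∃ π, π = p - q := ⟨_, rfl⟩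
  rw [← hπ] at hag ⊢
  have hπ0 : 0 ≤ π := by linarith
  refine (sum_outcomes_le hx ha hg hr hr1 hκ hκ1 (hq.trans hqp) hp hq (hqp.trans hp) hπ0
    (by linarith) hag).trans ?_
  have h1 := drift_coeff_le hx ha ha2 hg hr hp hπ hπ0 hqδ hδ hag hc hc4 hcr
  obtain ⟨hx0, hx1⟩ := hx
  obtain ⟨s, hs_def⟩ : ∃ s, s = x + a := ⟨_, rfl⟩
  rw [← hs_def] at h1 ⊢
  have hs : 0 < s := by rw [hs_def]; positivity
  have hy0 : 0 ≤ 1 - x := by linarith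
  have hκ' : 0 < 1 - κ := by linarith
  have e : x * (p * (1 / s - g * (1 - x) * (1 - π / 6) / s ^ 2)
          + (1 - p) * (1 / s + g * r * x / (1 - κ) / s ^ 2))
        + (1 - x) * (q * (1 / s + g * x * (1 + π / 3) / s ^ 2)
          + (1 - q) * (1 / s - g * r * (1 - x) * (1 / 2) / s ^ 2))
      = 1 / s + g * (1 - x) / s ^ 2 * (x * (-p * (1 - π / 6) + q * (1 + π / 3))
          - (1 - q) * r * (1 - x) / 2) + (1 - p) * (x ^ 2 / s ^ 2) * (g * r * (1 / (1 - κ))) := by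
    ring
  rw [e]
  have h2 := mul_le_mul_of_nonneg_left h1 (show 0 ≤ g * (1 - x) / s ^ 2 by positivity)
  have h3 : g * (1 - x) / s ^ 2 * -(c * π * s) = - (g * c * π * ((1 - x) * (1 / s))) := by
    field_simp
  have h4 : (1 - p) * (x ^ 2 / s ^ 2) * (g * r * (1 / (1 - κ)))
      ≤ 1 * 1 * (g * r * (1 / (1 - κ))) := by
    have hp1 : 1 - p ≤ 1 := by linarith
    have : x ^ 2 / s ^ 2 ≤ 1 := by
      rw [div_le_one (by positivity)]
      gcongr
      linarith
    gcongr
  rw [h3] at h2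
  rw [one_mul, one_mul] at h4
  exact add_le_add ((add_le_add_right h2 _).trans (sub_eq_add_neg _ _).ge) h4

/-! ### From the drift recursion to a √N bound. -/

/-- Summation of the drift inequality. -/
lemma sum_le_of_recursion {π c D B L : ℝ} {u w y : ℕ → ℝ} (hπ0 : 0 < π) (hπ1 : π ≤ 1)
    (hc : 0 < c) (hc1 : c ≤ 1) (hD : 0 ≤ D) (hB : 0 < B) (hL : 0 ≤ L)
    (hy1 : ∀ n, y n ≤ 1) (hu0 : ∀ n, 0 ≤ u n)
    (huL : ∀ n : ℕ, u n ≤ L * (π * √(n + 1))) (huw : ∀ n, u n - 1 ≤ w n)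
    (hyw : ∀ n : ℕ, B ≤ π * √(n + 1) → y n ≤ 2 * w n)
    (hrec : ∀ n : ℕ, B ≤ π * √(n + 1) →
      u (n + 1) ≤ u n - c * π / √(n + 1) * w n + D / (n + 1)) (N : ℕ) :
    π * ∑ k ∈ Finset.range N, y k
      ≤ (B + 2 / c * (max (L * (2 * B + 1)) (1 + D / (B * c)) + 2 * D)) * √N := by
  -- K bounds u once π√(n+1) ≥ B. The first entry covers the start of this regime, at n = 0 or just
  -- after crossing the threshold; the second is the level above which the contraction beats the
  -- noise D/(n+1).
  set K := max (L * (2 * B + 1)) (1 + D / (B * c)) with hK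
  have hK0 : 0 ≤ K := le_trans (by positivity) (le_max_right _ _)
  have triv : ∀ N : ℕ, π * √N ≤ B → π * ∑ k ∈ Finset.range N, y k ≤ B * √N := by
    intro N hN
    have h1 : ∑ k ∈ Finset.range N, y k ≤ N := by
      simpa using Finset.sum_le_card_nsmul (Finset.range N) y 1 (fun k _ => hy1 k)
    calc π * ∑ k ∈ Finset.range N, y k ≤ π * N := by gcongr
      _ = π * √N * √N := by rw [mul_assoc, Real.mul_self_sqrt (by positivity)]
      _ ≤ B * √N := by gcongr
  -- The boundary term √N · u N of the summation by parts is carried in the induction hypothesis.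
  have inv : ∀ N : ℕ, B ≤ π * √(N + 1) → u N ≤ K ∧
      π * ∑ k ∈ Finset.range N, y k + 2 / c * (√N * u N)
        ≤ (B + 2 / c * (K + 2 * D)) * √N := by
    intro N
    induction N with
    | zero =>
      intro _
      refine ⟨(huL 0).trans (le_trans ?_ (le_max_left _ _)), by simp⟩
      have : π * √((0 : ℕ) + 1) ≤ 2 * B + 1 := by
        simp
        linarith
      gcongr
    | succ n ih =>
      intro _
      set t := √((n : ℝ) + 1) with ht
      have ht0 : 0 < t := by positivity
      have htt : t * t = n + 1 := Real.mul_self_sqrt (by positivity)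
      have hcast : √((n + 1 : ℕ) : ℝ) = t := by rw [ht]; push_cast; rfl
      have hnt : √(n : ℝ) ≤ t := Real.sqrt_le_sqrt (by linarith)
      rcases le_or_gt B (π * t) with hBt | hBt
      · obtain ⟨ih1, ih2⟩ := ih hBt
        have hr := hrec n hBt
        rw [← ht, ← htt] at hr
        constructor
        · have hDt : D / (t * t) ≤ c * π / t * (D / (B * c)) := by
            have : c * π / t * (D / (B * c)) = D / (t * t) * (π * t / B) := by
              field_simp
            rw [this]
            have : 1 ≤ π * t / B := by rwa [one_le_div hB]
            exact le_mul_of_one_le_right (by positivity) this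
          set θ := c * π / t with hθ
          have hθ0 : 0 ≤ θ := by positivity
          have hθ1 : θ ≤ 1 := by
            rw [hθ, div_le_one ht0]
            have : 1 ≤ t := by
              rw [ht, Real.one_le_sqrt]
              have : (0 : ℝ) ≤ n := by positivity
              linarith
            nlinarith
          have h1 : θ * (u n - 1) ≤ θ * w n := by gcongr; exact huw n
          have h2 : 1 + D / (B * c) ≤ K := le_max_right _ _
          have h3 : (1 - θ) * u n ≤ (1 - θ) * K := by
            have : 0 ≤ 1 - θ := by linarith
            gcongr
          have h4 : θ * (1 + D / (B * c)) ≤ θ * K := by gcongr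
          linarith
        · rw [Finset.sum_range_succ, hcast]
          have hy := hyw n hBt
          have h1 : c * π * w n ≤ t * (u n - u (n + 1)) + D / t := by
            have := mul_le_mul_of_nonneg_left hr ht0.le
            have e : t * (u n - c * π / t * w n + D / (t * t))
                = t * u n - c * π * w n + D / t := by field_simp
            linarith
          have h2 : π * y n ≤ 2 / c * (t * (u n - u (n + 1)) + D / t) := by
            calc π * y n ≤ π * (2 * w n) := by gcongr
              _ = 2 / c * (c * π * w n) := by field_simp
              _ ≤ _ := by gcongr
          have hnn : √(n : ℝ) * √(n : ℝ) = n := Real.mul_self_sqrt (by positivity)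
          -- From 1 = (t - √n)(t + √n) ≤ 2t(t - √n); the right side telescopes.
          have h3 : D / t ≤ 2 * D * (t - √n) := by
            rw [div_le_iff₀ ht0]
            have : 1 ≤ 2 * (t - √n) * t := by nlinarith
            nlinarith
          have h4 : (t - √n) * u n ≤ (t - √n) * K := by
            have : 0 ≤ t - √n := by linarith
            gcongr
          have h5 : 2 / c * (t * (u n - u (n + 1)) + D / t)
              ≤ 2 / c * ((t - √n) * (K + 2 * D) + √n * u n - t * u (n + 1)) := by
            gcongr
            linarith
          have h6 : 0 ≤ B * (t - √n) := by
            have : 0 ≤ t - √n := by linarith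
            positivity
          have e : 2 / c * ((t - √n) * (K + 2 * D) + √n * u n - t * u (n + 1))
              = 2 / c * (K + 2 * D) * t - 2 / c * (K + 2 * D) * √n + 2 / c * (√n * u n)
                - 2 / c * (t * u (n + 1)) := by ring
          linarith
      -- The threshold is crossed between n and n + 1: the sum is still bounded trivially, and
      -- π√(n+2) ≤ 2πt bounds u.
      · have htwo : √(((n + 1 : ℕ) : ℝ) + 1) ≤ 2 * t := by
          rw [Real.sqrt_le_iff]
          refine ⟨by positivity, ?_⟩
          have : (0 : ℝ) ≤ n := by positivity
          push_cast
          nlinarith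
        have hu : u (n + 1) ≤ K := by
          refine (huL (n + 1)).trans (le_trans ?_ (le_max_left _ _))
          have : π * √(((n + 1 : ℕ) : ℝ) + 1) ≤ 2 * B + 1 := by
            calc π * √(((n + 1 : ℕ) : ℝ) + 1) ≤ π * (2 * t) := by gcongr
              _ ≤ 2 * B + 1 := by linarith
          gcongr
        refine ⟨hu, ?_⟩
        have h1 := triv (n + 1) (by rw [hcast]; exact hBt.le)
        rw [hcast] at h1 ⊢
        have h2 : 2 / c * (t * u (n + 1)) ≤ 2 / c * (t * (K + 2 * D)) := by
          gcongr
          linarith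
        linarith
  rcases le_or_gt B (π * √(N + 1)) with h | h
  · have := (inv N h).2
    have h2 : 0 ≤ 2 / c * (√N * u N) := by
      have := hu0 N
      positivity
    linarith
  · have h1 : π * √N ≤ B := le_trans (by gcongr; linarith) h.le
    refine (triv N h1).trans ?_
    gcongr
    have : 0 ≤ 2 / c * (K + 2 * D) := by positivity
    linarith

/-! ### Transition of the algorithm: measurability and expectations. -/

/-- The weight after one step, as a function of the previous weight, of the arm played and of
whether the reward is `1`. -/
def next (g r : ℝ) (i : Fin 2) (b : Bool) (x : ℝ) : ℝ :=
  if i = 0 then (if b then x + g * (1 - x) else x - g * r * x)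
  else (if b then x - g * x else x + g * r * (1 - x))

lemma next_mem {g r : ℝ} (hg : g ∈ Set.Icc (0 : ℝ) 1) (hr : r ∈ Set.Icc (0 : ℝ) 1) (i : Fin 2)
    (b : Bool) {x : ℝ} (hx : x ∈ Set.Icc (0 : ℝ) 1) : next g r i b x ∈ Set.Icc (0 : ℝ) 1 := by
  obtain ⟨hg0, hg1⟩ := hg
  obtain ⟨hr0, hr1⟩ := hr
  obtain ⟨hx0, hx1⟩ := hx
  have h1 : g * r ≤ 1 := mul_le_one₀ hg1 hr0 hr1
  have h0 : 0 ≤ g * r := mul_nonneg hg0 hr0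
  unfold next
  split_ifs <;> constructor <;> nlinarith

@[fun_prop]
lemma measurable_next (g r : ℝ) (i : Fin 2) (b : Bool) : Measurable (next g r i b) := by
  unfold next
  split_ifs <;> fun_prop

/-- The probability of playing arm `i` when the weight is `x`. -/
def armProb (i : Fin 2) (x : ℝ) : ℝ := if i = 0 then x else 1 - x

@[fun_prop]
lemma measurable_armProb (i : Fin 2) : Measurable (armProb i) := by
  unfold armProb
  split_ifs <;> fun_prop

lemma abs_armProb_le (i : Fin 2) {x : ℝ} (hx : x ∈ Set.Icc (0 : ℝ) 1) : |armProb i x| ≤ 1 := by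
  obtain ⟨hx0, hx1⟩ := hx
  unfold armProb
  split_ifs <;> rw [abs_le] <;> constructor <;> linarith

lemma history_mono {Ω : Type*} {A : ℕ → Fin 2 → Ω → ℝ} {I : ℕ → Ω → Fin 2} {X : ℕ → Ω → ℝ}
    {m n : ℕ} (hmn : m ≤ n) : history A I X m ≤ history A I X n :=
  sup_le_sup_left (biSup_mono fun _ hk => by
    simp only [Finset.mem_Icc] at hk ⊢
    omega) _

namespace IsPenalizedNS

variable {Ω : Type*} [mΩ : MeasurableSpace Ω] {μ : Measure Ω} {γ ρ : ℕ → ℝ}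
  {p : Fin 2 → unitInterval} {A : ℕ → Fin 2 → Ω → ℝ} {I : ℕ → Ω → Fin 2} {X : ℕ → Ω → ℝ}

lemma measurable_observed (h : IsPenalizedNS μ γ ρ p A I X) (n : ℕ) :
    Measurable fun ω => (I n ω, A n (I n ω) ω) := by
  refine (h.measurable_arm n).prodMk ?_
  have : (fun ω => A n (I n ω) ω) = fun ω => if I n ω = 0 then A n 0 ω else A n 1 ω := by
    funext ω
    split_ifs with h0
    · rw [h0]
    · rw [Fin.eq_one_of_ne_zero _ h0]
  rw [this]
  exact Measurable.ite (h.measurable_arm n (measurableSet_singleton 0)) (h.measurable_reward n 0)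
    (h.measurable_reward n 1)

lemma history_le (h : IsPenalizedNS μ γ ρ p A I X) (n : ℕ) : history A I X n ≤ mΩ :=
  sup_le h.measurable_init.comap_le (iSup₂_le fun k _ => (h.measurable_observed k).comap_le)

lemma measurable_weight_history (h : IsPenalizedNS μ γ ρ p A I X) (n : ℕ) :
    Measurable[history A I X n] (X n) := by
  induction n with
  | zero => exact Measurable.mono (comap_measurable (X 0)) le_sup_left le_rfl
  | succ n ih =>
    have hX : Measurable[history A I X (n + 1)] (X n) :=
      ih.mono (history_mono n.le_succ) le_rfl
    have hO : Measurable[history A I X (n + 1)] fun ω => (I (n + 1) ω, A (n + 1) (I (n + 1) ω) ω) :=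
      Measurable.mono (comap_measurable _)
        (le_sup_of_le_right (le_biSup (fun k => MeasurableSpace.comap
          (fun ω => (I k ω, A k (I k ω) ω)) inferInstance) (by simp))) le_rfl
    have hF : Measurable fun z : ℝ × (Fin 2 × ℝ) =>
        z.1 + γ (n + 1) * ((if z.2.1 = 0 then 1 else 0) - z.1) * z.2.2
          - γ (n + 1) * ρ (n + 1) * (z.1 * (if z.2.1 = 0 then 1 else 0)
            - (1 - z.1) * (if z.2.1 = 1 then 1 else 0)) * (1 - z.2.2) := by
      have hi : ∀ i : Fin 2, Measurable fun z : ℝ × (Fin 2 × ℝ) =>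
          if z.2.1 = i then (1 : ℝ) else 0 := fun i =>
        Measurable.ite (measurable_snd.fst (measurableSet_singleton i)) measurable_const
          measurable_const
      have h0 := hi 0
      have h1 := hi 1
      fun_prop
    have := hF.comp (hX.prodMk hO)
    convert this using 1
    funext ω
    exact h.update n ω

lemma measurable_weight (h : IsPenalizedNS μ γ ρ p A I X) (n : ℕ) : Measurable (X n) :=
  (h.measurable_weight_history n).mono (h.history_le n) le_rfl

lemma measurable_played (h : IsPenalizedNS μ γ ρ p A I X) (n : ℕ) (i : Fin 2) :
    Measurable fun ω => if I n ω = i then (1 : ℝ) else 0 :=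
  Measurable.ite (h.measurable_arm n (measurableSet_singleton i)) measurable_const
    measurable_const

lemma reward_ae (h : IsPenalizedNS μ γ ρ p A I X) (n : ℕ) (i : Fin 2) :
    ∀ᵐ ω ∂μ, A n i ω = 0 ∨ A n i ω = 1 := by
  have hs : MeasurableSet ({0, 1} : Set ℝ) := by measurability
  rw [(h.reward_law n i).ae_iff (p := fun x => x = 0 ∨ x = 1) (measurable_mem.2 hs), ae_iff]
  exact bernoulliMeasure_apply_of_notMem_of_notMem _ hs.compl (by simp) (by simp)

lemma integral_reward (h : IsPenalizedNS μ γ ρ p A I X) (n : ℕ) (i : Fin 2) :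
    ∫ ω, A n i ω ∂μ = p i := by
  rw [(h.reward_law n i).integral_eq, integral_bernoulliMeasure]
  simp

/-- The Bernoulli law makes rewards 0 or 1 only almost surely, so the form of the update by
outcomes, and hence the range [0,1] of the weights, holds only almost everywhere. -/
lemma update_ae (h : IsPenalizedNS μ γ ρ p A I X) (n : ℕ) : ∀ᵐ ω ∂μ,
    (∀ i, A (n + 1) i ω = 0 ∨ A (n + 1) i ω = 1) ∧ X (n + 1) ω =
      next (γ (n + 1)) (ρ (n + 1)) (I (n + 1) ω) (A (n + 1) (I (n + 1) ω) ω = 1) (X n ω) := by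
  filter_upwards [ae_all_iff.2 (h.reward_ae (n + 1))] with ω hA
  refine ⟨hA, ?_⟩
  rw [h.update n ω, next]
  rcases hA (I (n + 1) ω) with hb | hb <;> rw [hb] <;>
    rcases Fin.exists_fin_two.1 ⟨I (n + 1) ω, rfl⟩ with hi | hi <;> simp [hi] <;> ring

lemma weight_mem (h : IsPenalizedNS μ γ ρ p A I X)
    (hγ : ∀ n, γ (n + 1) ∈ Set.Icc (0 : ℝ) 1) (hρ : ∀ n, ρ (n + 1) ∈ Set.Icc (0 : ℝ) 1) (n : ℕ) :
    ∀ᵐ ω ∂μ, X n ω ∈ Set.Icc (0 : ℝ) 1 := by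
  induction n with
  | zero => exact ae_of_all _ h.init_mem
  | succ n ih =>
    filter_upwards [ih, h.update_ae n] with ω hω hu
    rw [hu.2]
    exact next_mem (hγ n) (hρ n) _ _ hω

lemma integrable_mul_played (h : IsPenalizedNS μ γ ρ p A I X) (n : ℕ) (i : Fin 2) {f : Ω → ℝ}
    (hf : Integrable f μ) : Integrable (fun ω => f ω * if I n ω = i then (1 : ℝ) else 0) μ := by
  refine hf.mul_bdd (c := 1) (h.measurable_played n i).aestronglyMeasurable (ae_of_all _ fun ω => ?_)
  split_ifs <;> simp

lemma integrable_mul_reward (h : IsPenalizedNS μ γ ρ p A I X) (n : ℕ) (i : Fin 2) {f : Ω → ℝ}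
    (hf : Integrable f μ) : Integrable (fun ω => f ω * A n i ω) μ := by
  refine hf.mul_bdd (c := 1) (h.measurable_reward n i).aestronglyMeasurable ?_
  filter_upwards [h.reward_ae n i] with ω hω
  rcases hω with hω | hω <;> simp [hω]

variable [IsProbabilityMeasure μ]

lemma integrable_comp_weight (h : IsPenalizedNS μ γ ρ p A I X) {n : ℕ}
    (hX : ∀ᵐ ω ∂μ, X n ω ∈ Set.Icc (0 : ℝ) 1) {g : ℝ → ℝ} (hg : Measurable g) {K : ℝ}
    (hK : ∀ x ∈ Set.Icc (0 : ℝ) 1, |g x| ≤ K) : Integrable (fun ω => g (X n ω)) μ := by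
  refine Integrable.of_bound (hg.comp (h.measurable_weight n)).aestronglyMeasurable K ?_
  filter_upwards [hX] with ω hω using hK _ hω

/-- The weight is adapted to the history, so g(X n) pulls out of the conditional expectation in
`arm_law`; the second arm follows by complement. -/
lemma integral_mul_played (h : IsPenalizedNS μ γ ρ p A I X) {n : ℕ}
    (hX : ∀ᵐ ω ∂μ, X n ω ∈ Set.Icc (0 : ℝ) 1) {g : ℝ → ℝ} (hg : Measurable g) {K : ℝ}
    (hK : ∀ x ∈ Set.Icc (0 : ℝ) 1, |g x| ≤ K) (i : Fin 2) :
    ∫ ω, g (X n ω) * (if I (n + 1) ω = i then 1 else 0) ∂μ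
      = ∫ ω, g (X n ω) * armProb i (X n ω) ∂μ := by
  have hgX := h.integrable_comp_weight hX hg hK
  have h0 : ∫ ω, g (X n ω) * (if I (n + 1) ω = 0 then 1 else 0) ∂μ
      = ∫ ω, g (X n ω) * X n ω ∂μ := by
    have hind : (({ω | I (n + 1) ω = 0} : Set Ω).indicator (fun _ => (1 : ℝ)))
        = fun ω => if I (n + 1) ω = 0 then (1 : ℝ) else 0 := by
      funext ω
      simp [Set.indicator_apply]
    have harm := h.arm_law n
    rw [hind] at harm
    have hint := h.integrable_mul_played (n + 1) 0 (integrable_const (μ := μ) (1 : ℝ))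
    simp only [one_mul] at hint
    have hpull := condExp_mul_of_aestronglyMeasurable_left (μ := μ) (m := history A I X n)
      (f := fun ω => g (X n ω)) (g := fun ω => if I (n + 1) ω = 0 then (1 : ℝ) else 0)
      (hg.comp (h.measurable_weight_history n)).stronglyMeasurable.aestronglyMeasurable
      (h.integrable_mul_played (n + 1) 0 hgX) hint
    have := integral_condExp (μ := μ) (h.history_le n)
      (f := (fun ω => g (X n ω)) * fun ω => if I (n + 1) ω = 0 then (1 : ℝ) else 0)
    rw [integral_congr_ae hpull] at this
    refine Eq.trans this.symm (integral_congr_ae ?_)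
    filter_upwards [harm] with ω hω
    rw [Pi.mul_apply, hω]
  rcases Fin.exists_fin_two.1 ⟨i, rfl⟩ with hi | hi <;> subst hi
  · simpa [armProb] using h0
  · have e1 : ∀ ω, g (X n ω) * (if I (n + 1) ω = 1 then 1 else 0)
        = g (X n ω) - g (X n ω) * (if I (n + 1) ω = 0 then 1 else 0) := by
      intro ω
      rcases Fin.exists_fin_two.1 ⟨I (n + 1) ω, rfl⟩ with hi | hi <;> simp [hi]
    have e2 : ∀ ω, g (X n ω) * armProb 1 (X n ω) = g (X n ω) - g (X n ω) * X n ω := by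
      intro ω
      simp [armProb]
      ring
    have hb : Integrable (fun ω => g (X n ω) * X n ω) μ := by
      refine hgX.mul_bdd (c := 1) (h.measurable_weight n).aestronglyMeasurable ?_
      filter_upwards [hX] with ω hω
      rw [Real.norm_eq_abs, abs_of_nonneg hω.1]
      exact hω.2
    simp_rw [e1, e2]
    rw [integral_sub hgX (h.integrable_mul_played _ _ hgX), integral_sub hgX hb, h0]

lemma integral_mul_played_mul_reward (h : IsPenalizedNS μ γ ρ p A I X) {n : ℕ}
    (hX : ∀ᵐ ω ∂μ, X n ω ∈ Set.Icc (0 : ℝ) 1) {g : ℝ → ℝ} (hg : Measurable g) {K : ℝ}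
    (hK : ∀ x ∈ Set.Icc (0 : ℝ) 1, |g x| ≤ K) (i j : Fin 2) :
    ∫ ω, g (X n ω) * (if I (n + 1) ω = i then 1 else 0) * A (n + 1) j ω ∂μ
      = (∫ ω, g (X n ω) * armProb i (X n ω) ∂μ) * p j := by
  have hm : Measurable[history A I X n ⊔ MeasurableSpace.comap (I (n + 1)) inferInstance]
      fun ω => g (X n ω) * (if I (n + 1) ω = i then (1 : ℝ) else 0) := by
    have hX' : Measurable[history A I X n ⊔ MeasurableSpace.comap (I (n + 1)) inferInstance]
        (X n) := (h.measurable_weight_history n).mono le_sup_left le_rfl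
    have hI' : Measurable[history A I X n ⊔ MeasurableSpace.comap (I (n + 1)) inferInstance]
        (I (n + 1)) := Measurable.mono (comap_measurable _) le_sup_right le_rfl
    exact (hg.comp hX').mul (Measurable.ite (hI' (measurableSet_singleton i)) measurable_const
      measurable_const)
  have hind : IndepFun (fun ω => g (X n ω) * (if I (n + 1) ω = i then (1 : ℝ) else 0))
      (A (n + 1) j) μ := by
    rw [IndepFun_iff_Indep]
    refine indep_of_indep_of_le_left (indep_of_indep_of_le_right (h.reward_indep_arm n).symm ?_)
      hm.comap_le
    have : Measurable[MeasurableSpace.comap (fun ω j => A (n + 1) j ω) inferInstance]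
        (A (n + 1) j) :=
      (measurable_pi_apply j).comp (comap_measurable (fun ω j => A (n + 1) j ω))
    exact this.comap_le
  rw [hind.integral_fun_mul_eq_mul_integral
    (((hg.comp (h.measurable_weight n)).mul (h.measurable_played _ i)).aestronglyMeasurable)
    (h.measurable_reward _ _).aestronglyMeasurable, h.integral_mul_played hX hg hK,
    h.integral_reward]

/-- Writing the integrand as g₀ + A(g₁ - g₀) on the event that arm i is played reduces to the two
preceding product formulas. -/
lemma integral_outcome (h : IsPenalizedNS μ γ ρ p A I X) {n : ℕ}
    (hX : ∀ᵐ ω ∂μ, X n ω ∈ Set.Icc (0 : ℝ) 1) {g₁ g₀ : ℝ → ℝ} (hg₁ : Measurable g₁)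
    (hg₀ : Measurable g₀) {K : ℝ} (hK₁ : ∀ x ∈ Set.Icc (0 : ℝ) 1, |g₁ x| ≤ K)
    (hK₀ : ∀ x ∈ Set.Icc (0 : ℝ) 1, |g₀ x| ≤ K) (i : Fin 2) :
    Integrable (fun ω => (if I (n + 1) ω = i then 1 else 0) *
      (A (n + 1) i ω * g₁ (X n ω) + (1 - A (n + 1) i ω) * g₀ (X n ω))) μ ∧
    ∫ ω, (if I (n + 1) ω = i then 1 else 0) *
      (A (n + 1) i ω * g₁ (X n ω) + (1 - A (n + 1) i ω) * g₀ (X n ω)) ∂μ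
      = ∫ ω, armProb i (X n ω) * (p i * g₁ (X n ω) + (1 - p i) * g₀ (X n ω)) ∂μ ∧
    Integrable (fun ω => armProb i (X n ω) * (p i * g₁ (X n ω) + (1 - p i) * g₀ (X n ω))) μ := by
  have hgd : Measurable fun x => g₁ x - g₀ x := hg₁.sub hg₀
  have hKd : ∀ x ∈ Set.Icc (0 : ℝ) 1, |g₁ x - g₀ x| ≤ K + K := fun x hx =>
    (abs_sub _ _).trans (add_le_add (hK₁ x hx) (hK₀ x hx))
  have hw : ∀ {f : ℝ → ℝ}, Integrable (fun ω => f (X n ω)) μ →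
      Integrable (fun ω => f (X n ω) * armProb i (X n ω)) μ := by
    intro f hf
    refine hf.mul_bdd (c := 1)
      ((measurable_armProb i).comp (h.measurable_weight n)).aestronglyMeasurable ?_
    filter_upwards [hX] with ω hω using abs_armProb_le i hω
  have hid := h.integrable_comp_weight hX hgd hKd
  have hi0 := h.integrable_comp_weight hX hg₀ hK₀
  have e1 : (fun ω => (if I (n + 1) ω = i then 1 else 0) *
      (A (n + 1) i ω * g₁ (X n ω) + (1 - A (n + 1) i ω) * g₀ (X n ω)))
      = fun ω => (g₁ (X n ω) - g₀ (X n ω)) * (if I (n + 1) ω = i then 1 else 0) * A (n + 1) i ω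
        + g₀ (X n ω) * (if I (n + 1) ω = i then 1 else 0) := by
    funext ω
    ring
  have e2 : (fun ω => armProb i (X n ω) * (p i * g₁ (X n ω) + (1 - p i) * g₀ (X n ω)))
      = fun ω => (g₁ (X n ω) - g₀ (X n ω)) * armProb i (X n ω) * p i
        + g₀ (X n ω) * armProb i (X n ω) := by
    funext ω
    ring
  have hid' := h.integrable_mul_reward (n + 1) i (h.integrable_mul_played (n + 1) i hid)
  have hi0' := h.integrable_mul_played (n + 1) i hi0
  have hwd := (hw (f := fun x => g₁ x - g₀ x) hid).mul_const (p i : ℝ)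
  rw [e1, e2]
  refine ⟨hid'.add hi0', ?_, hwd.add (hw hi0)⟩
  rw [integral_add hid' hi0', integral_add hwd (hw hi0), integral_mul_const,
    h.integral_mul_played_mul_reward hX hgd hKd, h.integral_mul_played hX hg₀ hK₀]

/-- The one-step transition of the algorithm, in expectation. -/
lemma integral_comp_weight_succ (h : IsPenalizedNS μ γ ρ p A I X) {n : ℕ}
    (hX : ∀ᵐ ω ∂μ, X n ω ∈ Set.Icc (0 : ℝ) 1)
    (hγ : γ (n + 1) ∈ Set.Icc (0 : ℝ) 1) (hρ : ρ (n + 1) ∈ Set.Icc (0 : ℝ) 1)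
    {f : ℝ → ℝ} (hf : Measurable f) {K : ℝ} (hK : ∀ x ∈ Set.Icc (0 : ℝ) 1, |f x| ≤ K) :
    Integrable (fun ω => ∑ i, armProb i (X n ω) *
      (p i * f (next (γ (n + 1)) (ρ (n + 1)) i true (X n ω))
        + (1 - p i) * f (next (γ (n + 1)) (ρ (n + 1)) i false (X n ω)))) μ ∧
    ∫ ω, f (X (n + 1) ω) ∂μ = ∫ ω, ∑ i, armProb i (X n ω) *
      (p i * f (next (γ (n + 1)) (ρ (n + 1)) i true (X n ω))
        + (1 - p i) * f (next (γ (n + 1)) (ρ (n + 1)) i false (X n ω))) ∂μ := by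
  have hout := fun i => h.integral_outcome hX
    (hf.comp (measurable_next (γ (n + 1)) (ρ (n + 1)) i true))
    (hf.comp (measurable_next (γ (n + 1)) (ρ (n + 1)) i false))
    (fun x hx => hK _ (next_mem hγ hρ i true hx)) (fun x hx => hK _ (next_mem hγ hρ i false hx)) i
  simp only [Function.comp_apply] at hout
  refine ⟨integrable_finsetSum _ fun i _ => (hout i).2.2, ?_⟩
  rw [integral_finsetSum _ fun i _ => (hout i).2.2]
  simp_rw [← fun i => (hout i).2.1]
  rw [← integral_finsetSum _ fun i _ => (hout i).1]
  refine integral_congr_ae ?_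
  filter_upwards [h.update_ae n] with ω hω
  rw [hω.2]
  rcases hω.1 (I (n + 1) ω) with hb | hb <;>
    rcases Fin.exists_fin_two.1 ⟨I (n + 1) ω, rfl⟩ with hi | hi <;> rw [hi] at hb ⊢ <;> simp [hb]

lemma integrable_reward_sub (h : IsPenalizedNS μ γ ρ p A I X) (k : ℕ) (j : Fin 2) :
    Integrable (fun ω => A k j ω - A k (I k ω) ω) μ := by
  refine Integrable.of_bound
    ((h.measurable_reward k j).sub (h.measurable_observed k).snd).aestronglyMeasurable 1 ?_
  filter_upwards [ae_all_iff.2 (h.reward_ae k)] with ω hω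
  rcases hω j with h1 | h1 <;> rcases hω (I k ω) with h2 | h2 <;> simp [h1, h2]

/-- Playing j itself contributes nothing, so only the event that the other arm i is played counts.
-/
lemma integral_reward_sub (h : IsPenalizedNS μ γ ρ p A I X) {n : ℕ}
    (hX : ∀ᵐ ω ∂μ, X n ω ∈ Set.Icc (0 : ℝ) 1) {i j : Fin 2} (hij : i ≠ j) :
    ∫ ω, (A (n + 1) j ω - A (n + 1) (I (n + 1) ω) ω) ∂μ
      = ((p j : ℝ) - p i) * ∫ ω, armProb i (X n ω) ∂μ := by
  have hint : ∀ k, Integrable (fun ω => (if I (n + 1) ω = i then (1 : ℝ) else 0)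
      * A (n + 1) k ω) μ := fun k => by
    have := h.integrable_mul_reward (n + 1) k
      (h.integrable_mul_played (n + 1) i (integrable_const (μ := μ) (1 : ℝ)))
    simpa only [one_mul] using this
  have hval : ∀ k, ∫ ω, (if I (n + 1) ω = i then (1 : ℝ) else 0) * A (n + 1) k ω ∂μ
      = (∫ ω, armProb i (X n ω) ∂μ) * p k := fun k => by
    have := h.integral_mul_played_mul_reward hX (g := fun _ => 1) measurable_const (K := 1)
      (by simp) i k
    simpa only [one_mul] using this
  have e : ∀ ω, A (n + 1) j ω - A (n + 1) (I (n + 1) ω) ω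
      = (if I (n + 1) ω = i then (1 : ℝ) else 0) * A (n + 1) j ω
        - (if I (n + 1) ω = i then (1 : ℝ) else 0) * A (n + 1) i ω := by
    intro ω
    by_cases hi : I (n + 1) ω = i
    · simp [hi]
    · have : I (n + 1) ω = j := by omega
      simp [this, hij.symm]
  simp_rw [e]
  rw [integral_sub (hint j) (hint i), hval, hval]
  ring

end IsPenalizedNS

/-! ### Expected drift and reduction of the regret to the weights. -/

namespace IsPenalizedNS

variable {Ω : Type*} [mΩ : MeasurableSpace Ω] {μ : Measure Ω} [IsProbabilityMeasure μ]
  {γ ρ : ℕ → ℝ} {p₁ p₂ : unitInterval} {A : ℕ → Fin 2 → Ω → ℝ} {I : ℕ → Ω → Fin 2}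
  {X : ℕ → Ω → ℝ}

lemma abs_one_div_add_le {a x : ℝ} (ha : 0 < a) (hx : x ∈ Set.Icc (0 : ℝ) 1) :
    |1 / (x + a)| ≤ 1 / a := by
  have := hx.1
  rw [abs_of_nonneg (by positivity)]
  gcongr
  linarith

lemma integrable_lyapunov {p : Fin 2 → unitInterval} (h : IsPenalizedNS μ γ ρ p A I X) {n : ℕ}
    (hX : ∀ᵐ ω ∂μ, X n ω ∈ Set.Icc (0 : ℝ) 1) {a : ℝ} (ha : 0 < a) :
    Integrable (fun ω => 1 / (X n ω + a)) μ :=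
  h.integrable_comp_weight hX (g := fun x => 1 / (x + a)) (by fun_prop)
    fun _ hx => abs_one_div_add_le ha hx

lemma integrable_one_sub_mul_lyapunov {p : Fin 2 → unitInterval}
    (h : IsPenalizedNS μ γ ρ p A I X) {n : ℕ}
    (hX : ∀ᵐ ω ∂μ, X n ω ∈ Set.Icc (0 : ℝ) 1) {a : ℝ} (ha : 0 < a) :
    Integrable (fun ω => (1 - X n ω) * (1 / (X n ω + a))) μ :=
  h.integrable_comp_weight hX (g := fun x => (1 - x) * (1 / (x + a))) (by fun_prop) (K := 1 / a)
    fun x hx => by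
      rw [abs_mul]
      refine (mul_le_of_le_one_left (abs_nonneg _) ?_).trans (abs_one_div_add_le ha hx)
      rw [abs_le]
      constructor <;> linarith [hx.1, hx.2]

lemma integral_lyapunov_succ_le (h : IsPenalizedNS μ γ ρ ![p₁, p₂] A I X) {n : ℕ}
    (hX : ∀ᵐ ω ∂μ, X n ω ∈ Set.Icc (0 : ℝ) 1) {a κ δ c : ℝ} (ha : 0 < a) (ha2 : a ≤ 1 / 2)
    (hγ0 : 0 < γ (n + 1)) (hγ1 : γ (n + 1) ≤ 1) (hρ0 : 0 < ρ (n + 1)) (hρ1 : ρ (n + 1) ≤ 1)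
    (hκ : γ (n + 1) * ρ (n + 1) ≤ κ) (hκ1 : κ < 1) (hqp : (p₂ : ℝ) ≤ p₁)
    (hqδ : (p₂ : ℝ) ≤ 1 - δ) (hδ : 0 ≤ δ) (hag : a * (p₁ - p₂) = 6 * γ (n + 1)) (hc : 0 ≤ c)
    (hc4 : c ≤ 1 / 4) (hcr : 48 * c * γ (n + 1) ≤ δ * ρ (n + 1)) :
    ∫ ω, 1 / (X (n + 1) ω + a) ∂μ ≤ ∫ ω, 1 / (X n ω + a) ∂μ
      - γ (n + 1) * c * (p₁ - p₂) * ∫ ω, (1 - X n ω) * (1 / (X n ω + a)) ∂μ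
      + γ (n + 1) * ρ (n + 1) * (1 / (1 - κ)) := by
  obtain ⟨hint, heq⟩ := h.integral_comp_weight_succ hX ⟨hγ0.le, hγ1⟩ ⟨hρ0.le, hρ1⟩
    (f := fun x => 1 / (x + a)) (by fun_prop) fun x hx => abs_one_div_add_le ha hx
  have hu := h.integrable_lyapunov hX ha
  have hw := (h.integrable_one_sub_mul_lyapunov hX ha).const_mul
    (γ (n + 1) * c * ((p₁ : ℝ) - p₂))
  have huw : Integrable (fun ω => 1 / (X n ω + a)
      - γ (n + 1) * c * (p₁ - p₂) * ((1 - X n ω) * (1 / (X n ω + a)))) μ := hu.sub hw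
  rw [heq, ← integral_const_mul, ← integral_sub hu hw]
  have hconst : γ (n + 1) * ρ (n + 1) * (1 / (1 - κ))
      = ∫ _, γ (n + 1) * ρ (n + 1) * (1 / (1 - κ)) ∂μ := by simp
  rw [hconst, ← integral_add huw (integrable_const _)]
  refine integral_mono_ae hint (huw.add (integrable_const _)) ?_
  filter_upwards [hX] with ω hω
  have := lyapunov_drift hω ha ha2 hγ0 hρ0 hρ1 hκ hκ1 p₁.2.2 p₂.2.1 hqp hqδ hδ hag hc hc4 hcr
  simpa [Fin.sum_univ_two, armProb, next] using this

lemma pseudoRegret_le (h : IsPenalizedNS μ γ ρ ![p₁, p₂] A I X)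
    (hX : ∀ n, ∀ᵐ ω ∂μ, X n ω ∈ Set.Icc (0 : ℝ) 1) (hqp : (p₂ : ℝ) ≤ p₁) (n : ℕ) :
    pseudoRegret μ A I n
      ≤ ((p₁ : ℝ) - p₂) * ∑ k ∈ Finset.range n, ∫ ω, (1 - X k ω) ∂μ := by
  have hsum : ∀ j, ∫ ω, ∑ k ∈ Finset.Icc 1 n, (A k j ω - A k (I k ω) ω) ∂μ
      = ∑ k ∈ Finset.range n, ∫ ω, (A (k + 1) j ω - A (k + 1) (I (k + 1) ω) ω) ∂μ := by
    intro j
    rw [integral_finsetSum _ fun k _ => h.integrable_reward_sub k j, Finset.range_eq_Ico,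
      Finset.sum_Ico_add' (fun k => ∫ ω, (A k j ω - A k (I k ω) ω) ∂μ) 0 n 1]
    rfl
  have hy : ∀ k, 0 ≤ ∫ ω, (1 - X k ω) ∂μ := fun k =>
    integral_nonneg_of_ae (by filter_upwards [hX k] with ω hω using sub_nonneg.2 hω.2)
  have hx : ∀ k, 0 ≤ ∫ ω, X k ω ∂μ := fun k =>
    integral_nonneg_of_ae (by filter_upwards [hX k] with ω hω using hω.1)
  refine Finset.sup'_le _ _ fun j _ => ?_
  rw [hsum, Finset.mul_sum]
  refine Finset.sum_le_sum fun k _ => ?_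
  rcases Fin.exists_fin_two.1 ⟨j, rfl⟩ with hj | hj <;> subst hj
  · rw [h.integral_reward_sub (hX k) (i := 1) (by decide)]
    simp [armProb]
  · rw [h.integral_reward_sub (hX k) (i := 0) (by decide)]
    refine le_trans ?_ (mul_nonneg (sub_nonneg.2 hqp) (hy k))
    simpa [armProb] using mul_nonpos_of_nonpos_of_nonneg (sub_nonpos.2 hqp) (hx k)

end IsPenalizedNS

/-! ### Effect of letting the shift a vary with time. -/

lemma sqrt_succ_le {m : ℝ} (hm : 0 < m) : √(m + 1) ≤ (1 + 1 / (2 * m)) * √m := by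
  rw [Real.sqrt_le_iff]
  refine ⟨by positivity, ?_⟩
  rw [mul_pow, Real.sq_sqrt hm.le]
  have : (1 + 1 / (2 * m)) ^ 2 * m = m + 1 + 1 / (4 * m) := by
    field_simp
    ring
  rw [this]
  have : 0 < 1 / (4 * m) := by positivity
  linarith

/-- Replacing a_n by a_{n+1} costs a factor 1 + 1/(2m). As v ≤ w + 1 + E, the extra term is at most
w/(2m) + O(1/m), and bπ√m ≥ 1 lets half of the drift absorb w/(2m). Hence b/2 in the conclusion. -/
lemma recursion_step {u u' v w E b π m : ℝ} (hm : 1 ≤ m) (hE : 0 ≤ E) (hπ : 0 ≤ π)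
    (hb : 0 ≤ b) (hbπ : 1 ≤ b * (π * √m)) (hw : 0 ≤ w) (huw : u - 1 ≤ w)
    (hv : v ≤ u - b * π / √m * w + E / m) (hu' : u' ≤ (1 + 1 / (2 * m)) * v) :
    u' ≤ u - b / 2 * π / √m * w + (1 / 2 + 2 * E) / m := by
  have hm0 : 0 < m := by linarith
  have ht : 0 < √m := Real.sqrt_pos.2 hm0
  have htt : √m * √m = m := Real.mul_self_sqrt hm0.le
  have hEm : E / m ≤ E := div_le_self hE hm
  have hbw : 0 ≤ b * π / √m * w := by positivity
  have h1 : 1 / (2 * m) * v ≤ 1 / (2 * m) * (w + 1 + E) := by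
    gcongr
    linarith
  have h2 : 1 / m * w ≤ b * π / √m * w := by
    refine mul_le_mul_of_nonneg_right ?_ hw
    rw [div_le_div_iff₀ hm0 ht]
    calc 1 * √m ≤ b * (π * √m) * √m := by gcongr
      _ = b * π * m := by linear_combination b * π * htt
  have h3 : 0 ≤ E / m := by positivity
  have e1 : 1 / (2 * m) * (w + 1 + E) = 1 / 2 * (1 / m * w) + 1 / 2 / m + 1 / 2 * (E / m) := by
    ring
  have e2 : b / 2 * π / √m * w = 1 / 2 * (b * π / √m * w) := by ring
  have e3 : (1 / 2 + 2 * E) / m = 1 / 2 / m + 2 * (E / m) := by ring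
  rw [e2, e3]
  linarith

end PenalizedNS

/-! ### Choice of constants and conclusion. -/

open PenalizedNS in
theorem mainTheorem2 (γ₁ ρ₁ : ℝ) (hγ₁ : γ₁ ∈ Set.Ioo (0 : ℝ) 1) (hρ₁ : ρ₁ ∈ Set.Ioo (0 : ℝ) 1)
    (δ : ℝ) (hδ : δ ∈ Set.Ioo (0 : ℝ) 1) :
    ∃ C : ℝ, 0 < C ∧ ∀ (n : ℕ) (p₁ p₂ : unitInterval), (p₂ : ℝ) ≤ min (p₁ : ℝ) (1 - δ) →
      ∀ (Ω : Type*) [MeasurableSpace Ω] (μ : MeasureTheory.Measure Ω)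
        [MeasureTheory.IsProbabilityMeasure μ]
        (A : ℕ → Fin 2 → Ω → ℝ) (I : ℕ → Ω → Fin 2) (X : ℕ → Ω → ℝ),
        PenalizedNS.IsPenalizedNS μ (PenalizedNS.invSqrt γ₁) (PenalizedNS.invSqrt ρ₁)
            ![p₁, p₂] A I X →
          PenalizedNS.pseudoRegret μ A I n ≤ C * √(n : ℝ) := by
  obtain ⟨hg0, hg1⟩ := hγ₁
  obtain ⟨hr0, hr1⟩ := hρ₁
  obtain ⟨hδ0, hδ1⟩ := hδ
  set κ := γ₁ * ρ₁ with hκ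
  have hκ0 : 0 < κ := by positivity
  have hκ1 : κ < 1 := mul_lt_one_of_nonneg_of_lt_one_left hg0.le hg1 hr1.le
  have hκ' : 0 < 1 - κ := by linarith
  set c := min (1 / 4) (δ * ρ₁ / (48 * γ₁)) with hc
  have hc0 : 0 < c := lt_min (by norm_num) (by positivity)
  have hc4 : c ≤ 1 / 4 := min_le_left _ _
  have hcr : 48 * c * γ₁ ≤ δ * ρ₁ := by
    have : c ≤ δ * ρ₁ / (48 * γ₁) := min_le_right _ _
    rw [le_div_iff₀ (by positivity)] at this
    linarith
  set E := κ * (1 / (1 - κ)) with hE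
  have hE0 : 0 ≤ E := by positivity
  set b := γ₁ * c with hb
  have hb0 : 0 < b := by positivity
  have hb1 : b / 2 ≤ 1 := by
    have : γ₁ * c ≤ 1 * (1 / 4) := by gcongr
    linarith
  -- The first entry ensures a k ≤ 1/2, the second bπ√(k+1) ≥ 1.
  set B := max (12 * γ₁) (1 / b) with hB
  have hB0 : 0 < B := lt_max_of_lt_left (by positivity)
  set D := 1 / 2 + 2 * E with hD
  have hD0 : 0 ≤ D := by positivity
  set L := 1 / (6 * γ₁) with hL
  have hL0 : 0 ≤ L := by positivity
  have hM : 0 ≤ max (L * (2 * B + 1)) (1 + D / (B * (b / 2))) :=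
    le_trans (by positivity) (le_max_right _ _)
  refine ⟨B + 2 / (b / 2) * (max (L * (2 * B + 1)) (1 + D / (B * (b / 2))) + 2 * D),
    by positivity, ?_⟩
  intro n p₁ p₂ hp Ω _ μ _ A I X h
  have hqp : (p₂ : ℝ) ≤ p₁ := hp.trans (min_le_left _ _)
  have hqδ : (p₂ : ℝ) ≤ 1 - δ := hp.trans (min_le_right _ _)
  have ht1 : ∀ k : ℕ, 1 ≤ √((k : ℝ) + 1) := fun k => by
    rw [Real.one_le_sqrt]
    have : (0 : ℝ) ≤ k := by positivity
    linarith
  have hstep : ∀ {z : ℝ}, 0 < z → z < 1 → ∀ k, invSqrt z (k + 1) = z / √(k + 1) ∧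
      0 < invSqrt z (k + 1) ∧ invSqrt z (k + 1) ≤ 1 := by
    intro z hz0 hz1 k
    have e : invSqrt z (k + 1) = z / √(k + 1) := by simp [invSqrt]
    have := ht1 k
    rw [e]
    refine ⟨rfl, by positivity, ?_⟩
    rw [div_le_one (by positivity)]
    linarith
  have hX : ∀ k, ∀ᵐ ω ∂μ, X k ω ∈ Set.Icc (0 : ℝ) 1 := h.weight_mem
    (fun k => ⟨(hstep hg0 hg1 k).2.1.le, (hstep hg0 hg1 k).2.2⟩)
    (fun k => ⟨(hstep hr0 hr1 k).2.1.le, (hstep hr0 hr1 k).2.2⟩)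
  refine (h.pseudoRegret_le hX hqp n).trans ?_
  -- Equal arms are treated apart, since the shift divides by π.
  rcases hqp.eq_or_lt with heq | hlt
  · rw [heq, sub_self, zero_mul]
    positivity
  have hπ0 : 0 < (p₁ : ℝ) - p₂ := sub_pos.2 hlt
  have hπ1 : (p₁ : ℝ) - p₂ ≤ 1 := by linarith [p₁.2.2, p₂.2.1]
  set π := (p₁ : ℝ) - p₂ with hπ
  -- The index is k + 1 because the move from X k uses γ_{k+1}: thus a k · π = 6γ_{k+1}.
  set a : ℕ → ℝ := fun k => 6 * γ₁ / (π * √(k + 1)) with ha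
  have ha0 : ∀ k, 0 < a k := fun k => by positivity
  have hw0 : ∀ k, 0 ≤ ∫ ω, (1 - X k ω) * (1 / (X k ω + a k)) ∂μ := fun k =>
    integral_nonneg_of_ae <| by
      filter_upwards [hX k] with ω hω
      have h1 := hω.1
      have h2 := sub_nonneg.2 hω.2
      have h3 := ha0 k
      positivity
  have huw : ∀ k, ∫ ω, 1 / (X k ω + a k) ∂μ - 1
      ≤ ∫ ω, (1 - X k ω) * (1 / (X k ω + a k)) ∂μ := by
    intro k
    have hone : (1 : ℝ) = ∫ _, (1 : ℝ) ∂μ := by simp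
    rw [sub_le_iff_le_add]
    nth_rw 4 [hone]
    rw [← integral_add (h.integrable_one_sub_mul_lyapunov (hX k) (ha0 k)) (integrable_const _)]
    refine integral_mono_ae (h.integrable_lyapunov (hX k) (ha0 k))
      ((h.integrable_one_sub_mul_lyapunov (hX k) (ha0 k)).add (integrable_const _)) ?_
    filter_upwards [hX k] with ω hω
    have h1 := hω.1
    have h3 := ha0 k
    have : X k ω * (1 / (X k ω + a k)) ≤ 1 := by
      rw [mul_one_div, div_le_one (by positivity)]
      linarith
    linarith
  have ha2 : ∀ k : ℕ, B ≤ π * √(k + 1) → a k ≤ 1 / 2 := fun k hk => by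
    have := (le_max_left (12 * γ₁) (1 / b)).trans hk
    have h1 := ht1 k
    rw [ha, div_le_iff₀ (by positivity)]
    linarith
  have hint : ∀ k, Integrable (fun ω => 1 - X k ω) μ := fun k =>
    h.integrable_comp_weight (hX k) (g := fun x => 1 - x) (by fun_prop) (K := 1) fun x hx => by
      rw [abs_le]
      constructor <;> linarith [hx.1, hx.2]
  refine sum_le_of_recursion (u := fun k => ∫ ω, 1 / (X k ω + a k) ∂μ)
    (w := fun k => ∫ ω, (1 - X k ω) * (1 / (X k ω + a k)) ∂μ) hπ0 hπ1 (half_pos hb0) hb1 hD0 hB0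
    hL0 ?_ ?_ ?_ huw ?_ ?_ n
  · intro k
    have := integral_mono_ae (hint k) (integrable_const (1 : ℝ)) (by
      filter_upwards [hX k] with ω hω
      linarith [hω.1])
    simpa using this
  · intro k
    refine integral_nonneg_of_ae ?_
    filter_upwards [hX k] with ω hω
    have h1 := hω.1
    have h3 := ha0 k
    positivity
  · intro k
    have := integral_mono_ae (h.integrable_lyapunov (hX k) (ha0 k))
      (integrable_const (1 / a k)) (by
        filter_upwards [hX k] with ω hω
        exact (le_abs_self _).trans (IsPenalizedNS.abs_one_div_add_le (ha0 k) hω))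
    refine this.trans (le_of_eq ?_)
    simp [ha, hL]
    field_simp
  · intro k hk
    rw [← integral_const_mul]
    refine integral_mono_ae (hint k)
      ((h.integrable_one_sub_mul_lyapunov (hX k) (ha0 k)).const_mul _) ?_
    filter_upwards [hX k] with ω hω
    have h1 := hω.1
    have h2 := sub_nonneg.2 hω.2
    have h3 := ha0 k
    have h4 := ha2 k hk
    have h5 : 1 ≤ 2 * (1 / (X k ω + a k)) := by
      rw [mul_one_div, one_le_div (by positivity)]
      linarith [hω.2]
    have := mul_le_mul_of_nonneg_left h5 h2
    linarith
  · intro k hk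
    obtain ⟨eg, hgk0, hgk1⟩ := hstep hg0 hg1 k
    obtain ⟨er, hrk0, hrk1⟩ := hstep hr0 hr1 k
    have hm : (1 : ℝ) ≤ (k : ℝ) + 1 := by
      have : (0 : ℝ) ≤ k := by positivity
      linarith
    have ht := ht1 k
    have htt : √((k : ℝ) + 1) * √((k : ℝ) + 1) = k + 1 := Real.mul_self_sqrt (by positivity)
    have egr : invSqrt γ₁ (k + 1) * invSqrt ρ₁ (k + 1) = κ / (k + 1) := by
      rw [eg, er, div_mul_div_comm, htt]
    have hv := h.integral_lyapunov_succ_le (hX k) (ha0 k) (ha2 k hk) hgk0 hgk1 hrk0 hrk1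
      (κ := κ) (δ := δ) (c := c) (by rw [egr]; exact div_le_self hκ0.le hm) hκ1 hqp hqδ hδ0.le
      (by
        rw [eg, ← hπ]
        simp only [ha]
        field_simp) hc0.le hc4 (by
        rw [eg, er, ← mul_div_assoc, ← mul_div_assoc]
        gcongr)
    rw [egr, eg, ← hπ] at hv
    refine recursion_step (b := b) (E := E) (v := ∫ ω, 1 / (X (k + 1) ω + a k) ∂μ) hm hE0 hπ0.le
      hb0.le ?_ (hw0 k) (huw k) (hv.trans (le_of_eq ?_)) ?_
    · have := (le_max_right (12 * γ₁) (1 / b)).trans hk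
      rwa [div_le_iff₀' hb0] at this
    · rw [hE, hb]
      ring
    · rw [← integral_const_mul]
      refine integral_mono_ae (h.integrable_lyapunov (hX (k + 1)) (ha0 (k + 1)))
        ((h.integrable_lyapunov (hX (k + 1)) (ha0 k)).const_mul _) ?_
      filter_upwards [hX (k + 1)] with ω hω
      have h1 := hω.1
      have h2 := ha0 k
      have h3 := ha0 (k + 1)
      have h4 : a k ≤ (1 + 1 / (2 * ((k : ℝ) + 1))) * a (k + 1) := by
        simp only [ha]
        have := sqrt_succ_le (m := (k : ℝ) + 1) (by positivity)
        push_cast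
        rw [← mul_div_assoc, div_le_div_iff₀ (by positivity) (by positivity)]
        calc 6 * γ₁ * (π * √((k : ℝ) + 1 + 1))
            ≤ 6 * γ₁ * (π * ((1 + 1 / (2 * ((k : ℝ) + 1))) * √((k : ℝ) + 1))) := by gcongr
          _ = _ := by ring
      rw [mul_one_div, div_le_div_iff₀ (by positivity) (by positivity)]
      have h5 : 0 ≤ 1 / (2 * ((k : ℝ) + 1)) * X (k + 1) ω := by positivity
      linarith
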